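/- A partition of $n$ with designated summands is a partition of $n$ together with, for each distinct part size occurring in it, the choice of exactly one of the occurrences of that part. Let $PD_2(n)$ denote the number of partitions of $n$ with designated summands in which all parts are odd. Then for all integers $\alpha \ge 0$ and $n \ge 0$, $$PD_2\bigl(2^\alpha(4n+3)\bigr) \equiv 0 \pmod 4.$$ In particular, for all $n \ge 0$, $PD_2(16n+12) \equiv 0 \pmod 4$ and $PD_2(32n+24) \equiv 0 \pmod 4$ (these are two of the congruences conjectured by Herden et al.). -/

import Mathlib

/-- A partition of `n` with designated summands: a partition `p` of `n`, together with, for each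
distinct part `i` of `p`, the choice of exactly one of the occurrences of `i` in `p`. The
occurrences of `i` are numbered by `Fin (p.parts.count i)`. -/
abbrev DesignatedPartition (n : ℕ) : Type :=
  Σ p : n.Partition, (i : {i : ℕ // i ∈ p.parts.toFinset}) → Fin (p.parts.count (i : ℕ))

/-- `PD k n` is the number of `k`-regular partitions of `n` with designated summands, that is,
those in which no part is divisible by `k`. For `k = 2` these are the partitions of `n` with
designated summands in which all parts are odd. -/
def PD (k n : ℕ) : ℕ :=
  Fintype.card {x : DesignatedPartition n // ∀ i ∈ x.1.parts, ¬ k ∣ i}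

/-! Write f_k for `eulerProd k` and G for the generating function of `PD 2`. A part of multiplicity
c admits c designations, so G is the product over odd i of 1 + ∑ c q^(ci) = (1 - q^i + q^(2i)) / (1
- q^i)^2, that is, G = f_4 f_6^2 / (f_1 f_3 f_12). Modulo 4, φ^2 = 1 and φ(q) f_1^2 = f_2. With
Gauss' ψ(q) = f_2^2 / f_1 this gives G = φ(q^2) ψ(q) ψ(q^3) / f_12, which
`psiSeries_mul_psiSeries_three` splits by parity. The odd part is q times a series in q^4, so it has
no exponent 4n + 3 (`PDSeries_two_dissection`). The even part, with q^2 replaced by q, is G(q^2)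
plus q times a series in q^4 (`phiSeries_mul_psiSeries_dissection`). Hence `PD 2 (2m)` vanishes mod
4 for m = 4n + 3, and `PD 2 (4m)` agrees with `PD 2 m`. Induction on α in steps of two finishes. -/

open PowerSeries
open scoped PowerSeries.WithPiTopology

/-- The power series `∑ i, X ^ e i`; the exponents `e i` are meant to be nonnegative and `e` is
meant to have finite fibres. -/
noncomputable def thetaSeries (R : Type*) [Semiring R] {ι : Type*} (e : ι → ℤ) : R⟦X⟧ :=
  PowerSeries.mk fun n => ({i | e i = (n : ℤ)}.ncard : R)

/-! ### Calculus of theta series: identities reduce to exponent-preserving bijections of index sets.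
-/

namespace thetaSeries

variable {R : Type*} [CommRing R] {ι κ : Type*}

theorem coeff_eq (e : ι → ℤ) (n : ℕ) :
    coeff n (thetaSeries R e) = ({i | e i = (n : ℤ)}.ncard : R) := coeff_mk _ _

theorem congr_equiv {e : ι → ℤ} {e' : κ → ℤ} (σ : ι ≃ κ) (h : ∀ i, e' (σ i) = e i) :
    thetaSeries R e = thetaSeries R e' := by
  ext n
  rw [coeff_eq, coeff_eq, ← Set.ncard_image_of_injective _ σ.injective]
  congr 2
  ext j
  simp only [Set.mem_image, Set.mem_ofPred_eq]
  constructor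
  · rintro ⟨i, hi, rfl⟩; rw [h, hi]
  · intro hj; exact ⟨σ.symm j, by rw [← h]; simpa using hj, by simp⟩

theorem sum_elim {e : ι → ℤ} {e' : κ → ℤ} (he : ∀ n : ℤ, {i | e i = n}.Finite)
    (he' : ∀ n : ℤ, {i | e' i = n}.Finite) :
    thetaSeries R (Sum.elim e e') = thetaSeries R e + thetaSeries R e' := by
  ext n
  rw [map_add, coeff_eq, coeff_eq, coeff_eq, ← Nat.cast_add,
    ← Set.ncard_image_of_injective {i | e i = (n : ℤ)} (Sum.inl_injective (β := κ)),
    ← Set.ncard_image_of_injective {i | e' i = (n : ℤ)} (Sum.inr_injective (α := ι)),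
    ← Set.ncard_union_eq _ ((he n).image _) ((he' n).image _)]
  · congr 2
    ext (i | i) <;> simp
  · rw [Set.disjoint_left]
    rintro _ ⟨i, _, rfl⟩ ⟨j, _, h⟩
    simp at h

theorem mul_eq {e : ι → ℤ} {e' : κ → ℤ} (h0 : ∀ i, 0 ≤ e i) (h0' : ∀ i, 0 ≤ e' i)
    (he : ∀ n : ℤ, {i | e i = n}.Finite) (he' : ∀ n : ℤ, {i | e' i = n}.Finite) :
    thetaSeries R e * thetaSeries R e' = thetaSeries R fun p : ι × κ => e p.1 + e' p.2 := by
  classical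
  ext n
  have key : {p : ι × κ | e p.1 + e' p.2 = (n : ℤ)} =
      ↑((Finset.HasAntidiagonal.antidiagonal n).biUnion fun p =>
        (he p.1).toFinset ×ˢ (he' p.2).toFinset) := by
    ext ⟨i, j⟩
    simp only [Set.mem_ofPred_eq, Finset.coe_biUnion, Finset.mem_coe, Finset.HasAntidiagonal.mem_antidiagonal,
      Set.mem_iUnion, Finset.mem_product, Set.Finite.mem_toFinset, exists_prop, Prod.exists]
    constructor
    · intro h
      refine ⟨(e i).toNat, (e' j).toNat, ?_, ?_, ?_⟩ <;> have := h0 i <;> have := h0' j <;> omega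
    · rintro ⟨a, b, h, h1, h2⟩; omega
  rw [coeff_mul, coeff_eq, key, Set.ncard_coe_finset, Finset.card_biUnion, Nat.cast_sum]
  · refine Finset.sum_congr rfl fun p _ => ?_
    rw [coeff_eq, coeff_eq, Finset.card_product, Set.ncard_eq_toFinset_card _ (he _),
      Set.ncard_eq_toFinset_card _ (he' _), Nat.cast_mul]
  · rintro ⟨a, b⟩ _ ⟨c, d⟩ _ h
    rw [Function.onFun, Finset.disjoint_left]
    rintro ⟨i, j⟩ h1 h2
    simp only [Finset.mem_product, Set.Finite.mem_toFinset, Set.mem_ofPred_eq] at h1 h2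
    apply h
    ext <;> simp <;> omega

theorem X_pow_mul {e : ι → ℤ} (h0 : ∀ i, 0 ≤ e i) (k : ℕ) :
    X ^ k * thetaSeries R e = thetaSeries R fun i => k + e i := by
  ext n
  rw [coeff_X_pow_mul', coeff_eq]
  split_ifs with h
  · rw [coeff_eq]
    congr 2
    ext i
    simp only [Set.mem_ofPred_eq]
    omega
  · rw [eq_comm, coeff_eq, show {i | (k : ℤ) + e i = n} = ∅ from ?_, Set.ncard_empty,
      Nat.cast_zero]
    ext i
    have := h0 i
    simp only [Set.mem_ofPred_eq, Set.mem_empty_iff_false, iff_false]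
    omega

theorem expand_eq {e : ι → ℤ} (k : ℕ) (hk : k ≠ 0) :
    expand k hk (thetaSeries R e) = thetaSeries R fun i => k * e i := by
  ext n
  rw [coeff_expand, coeff_eq, coeff_eq]
  have hk' : (k : ℤ) ≠ 0 := by exact_mod_cast hk
  split_ifs with h
  · obtain ⟨m, rfl⟩ := h
    rw [Nat.mul_div_cancel_left _ (by omega)]
    congr 2
    ext i
    simp [hk]
  · rw [eq_comm, show {i | (k : ℤ) * e i = n} = ∅ from ?_, Set.ncard_empty, Nat.cast_zero]
    ext i
    simp only [Set.mem_ofPred_eq, Set.mem_empty_iff_false, iff_false]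
    intro hi
    exact h (by exact_mod_cast Dvd.intro _ hi)

end thetaSeries

theorem finite_fibre_of_abs_le {e : ℤ → ℤ} (h : ∀ i, |i| ≤ e i) (n : ℤ) : {i | e i = n}.Finite := by
  refine (Set.finite_Icc (-n) n).subset fun i hi => ?_
  have := abs_le.1 (h i)
  simp only [Set.mem_ofPred_eq] at hi
  simp only [Set.mem_Icc]
  omega

theorem finite_fibre_prod {e e' : ℤ → ℤ} (h : ∀ i, |i| ≤ e i) (h' : ∀ i, |i| ≤ e' i) (n : ℤ) :
    {p : ℤ × ℤ | e p.1 + e' p.2 = n}.Finite := by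
  refine ((Set.finite_Icc (-n) n).prod (Set.finite_Icc (-n) n)).subset fun p hp => ?_
  have h1 := h p.1
  have h2 := h' p.2
  have := abs_le.1 h1
  have := abs_le.1 h2
  have := abs_nonneg p.1
  have := abs_nonneg p.2
  simp only [Set.mem_ofPred_eq] at hp
  simp only [Set.mem_prod, Set.mem_Icc]
  omega

/-! ### Ramanujan's φ and ψ, and their dissections. -/

section Theta

variable (R : Type*) [CommRing R]

/-- Ramanujan's theta series `φ(X ^ k) = ∑ X ^ (k n²)`, over `n : ℤ`. -/
noncomputable def phiSeries (k : ℕ) : R⟦X⟧ := thetaSeries R fun n : ℤ => k * n ^ 2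

/-- Ramanujan's theta series `ψ(X ^ k) = ∑ X ^ (k n (2 n + 1))`, over `n : ℤ`. The exponents
`n (2 n + 1)` are the triangular numbers. -/
noncomputable def psiSeries (k : ℕ) : R⟦X⟧ := thetaSeries R fun n : ℤ => k * (n * (2 * n + 1))

variable {R}

theorem abs_le_phi_exponent {k : ℕ} (hk : 0 < k) (n : ℤ) : |n| ≤ k * n ^ 2 := by
  have hk' : (1 : ℤ) ≤ k := by exact_mod_cast hk
  have h : |n| ≤ n ^ 2 := by
    rw [← sq_abs, ← Int.natCast_natAbs]
    exact_mod_cast Nat.le_self_pow two_ne_zero _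
  nlinarith [sq_nonneg n]

theorem abs_le_psi_exponent {k : ℕ} (hk : 0 < k) (n : ℤ) : |n| ≤ k * (n * (2 * n + 1)) := by
  have hk' : (1 : ℤ) ≤ k := by exact_mod_cast hk
  have h : |n| ≤ n * (2 * n + 1) := by
    have h := abs_le_phi_exponent one_pos n
    have := neg_abs_le n
    push_cast at h
    nlinarith
  have := abs_nonneg n
  nlinarith

theorem expand_phiSeries (j : ℕ) (hj : j ≠ 0) (k : ℕ) :
    expand j hj (phiSeries R k) = phiSeries R (j * k) := by
  simp [phiSeries, thetaSeries.expand_eq, mul_assoc]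

theorem expand_psiSeries (j : ℕ) (hj : j ≠ 0) (k : ℕ) :
    expand j hj (psiSeries R k) = psiSeries R (j * k) := by
  simp [psiSeries, thetaSeries.expand_eq, mul_assoc]

theorem nonneg_of_abs_le {e : ℤ → ℤ} (h : ∀ i, |i| ≤ e i) (i : ℤ) : 0 ≤ e i :=
  (abs_nonneg i).trans (h i)

theorem thetaSeries_mul_thetaSeries {e e' : ℤ → ℤ} (h : ∀ i, |i| ≤ e i) (h' : ∀ i, |i| ≤ e' i) :
    thetaSeries R e * thetaSeries R e' = thetaSeries R fun p : ℤ × ℤ => e p.1 + e' p.2 :=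
  thetaSeries.mul_eq (nonneg_of_abs_le h) (nonneg_of_abs_le h') (finite_fibre_of_abs_le h)
    (finite_fibre_of_abs_le h')

/-- The substitution behind the 2-dissection of `ψ(q) ψ(q³)`. -/
def psiMulPsiEquiv : (ℤ × ℤ) ⊕ (ℤ × ℤ) ≃ ℤ × ℤ where
  toFun := Sum.elim
    (fun p => if p.2 % 2 = 0 then (2 * p.2 + (p.1 - p.2 / 2), p.1 - p.2 / 2)
      else (2 * p.2 + (-p.1 - p.2 / 2 - 1), -p.1 - p.2 / 2 - 1))
    (fun p => if p.1 % 2 = 0 then (p.1 / 2 - 3 * p.2 - 1, p.1 / 2 + p.2)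
      else (3 * p.2 + (p.1 - 1) / 2 + 1, (p.1 - 1) / 2 - p.2))
  invFun p :=
    if (p.1 - p.2) % 2 = 0 then
      Sum.inl (if (p.1 - p.2) % 4 = 0 then ((p.1 + 3 * p.2) / 4, (p.1 - p.2) / 2)
        else ((-p.1 - 3 * p.2 - 2) / 4, (p.1 - p.2) / 2))
    else
      Sum.inr (if (p.1 + 3 * p.2 + 1) % 4 = 0 then
        ((p.1 + 3 * p.2 + 1) / 2, (p.2 - p.1 - 1) / 4)
        else ((p.1 + 3 * p.2 + 1) / 2, (p.1 - p.2 - 1) / 4))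
  left_inv := by
    rintro (⟨k, w⟩ | ⟨w, k⟩)
    · simp only [Sum.elim_inl]
      rcases Int.emod_two_eq_zero_or_one w with h | h
      · simp only [h, if_true]
        rw [if_pos (by omega), if_pos (by omega)]
        congr 2 <;> omega
      · simp only [h, one_ne_zero, if_false]
        rw [if_pos (by omega), if_neg (by omega)]
        congr 2 <;> omega
    · simp only [Sum.elim_inr]
      rcases Int.emod_two_eq_zero_or_one w with h | h
      · simp only [h, if_true]
        rw [if_neg (by omega), if_pos (by omega)]
        congr 2 <;> omega
      · simp only [h, one_ne_zero, if_false]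
        rw [if_neg (by omega), if_neg (by omega)]
        congr 2 <;> omega
  right_inv := by
    rintro ⟨a, b⟩
    dsimp only
    split_ifs with h1 h2 h2
    · simp only [Sum.elim_inl]
      rw [if_pos (by omega)]
      ext <;> dsimp only <;> omega
    · simp only [Sum.elim_inl]
      rw [if_neg (by omega)]
      ext <;> dsimp only <;> omega
    · simp only [Sum.elim_inr]
      rw [if_pos (by omega)]
      ext <;> dsimp only <;> omega
    · simp only [Sum.elim_inr]
      rw [if_neg (by omega)]
      ext <;> dsimp only <;> omega

/-- If E is the exponent at (a, b) on the left, completing squares gives 8E + 4 = (4a+1)^2 +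
3(4b+1)^2 = 4(a+3b+1)^2 + 12(a-b)^2. For a - b even, put a - b = 2w and a + 3b + 1 = ±(4k+1); for a
- b odd, put a + 3b + 1 = 2w and a - b = ±(4k+1). The two cases give the two products on the right.
-/
theorem psiSeries_mul_psiSeries_three :
    psiSeries R 1 * psiSeries R 3 =
      psiSeries R 4 * phiSeries R 6 + X * (phiSeries R 2 * psiSeries R 12) := by
  have p (k : ℕ) (hk : 0 < k) := abs_le_phi_exponent hk
  have s (k : ℕ) (hk : 0 < k) := abs_le_psi_exponent hk
  have h2 := finite_fibre_prod (p 2 (by simp)) (s 12 (by simp))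
  rw [psiSeries, psiSeries, psiSeries, psiSeries, phiSeries, phiSeries,
    thetaSeries_mul_thetaSeries (s 1 (by simp)) (s 3 (by simp)),
    thetaSeries_mul_thetaSeries (s 4 (by simp)) (p 6 (by simp)),
    thetaSeries_mul_thetaSeries (p 2 (by simp)) (s 12 (by simp)), ← pow_one X,
    thetaSeries.X_pow_mul, ← thetaSeries.sum_elim (finite_fibre_prod (s 4 (by simp)) (p 6 (by simp)))]
  · symm
    refine thetaSeries.congr_equiv psiMulPsiEquiv ?_
    rintro (⟨k, w⟩ | ⟨w, k⟩)
    · simp only [psiMulPsiEquiv, Equiv.coe_fn_mk, Sum.elim_inl]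
      obtain ⟨t, rfl | rfl⟩ := Int.even_or_odd' w
      · rw [if_pos (by omega), show 2 * t / 2 = t by omega]
        push_cast; ring
      · rw [if_neg (by omega), show (2 * t + 1) / 2 = t by omega]
        push_cast; ring
    · simp only [psiMulPsiEquiv, Equiv.coe_fn_mk, Sum.elim_inr]
      obtain ⟨t, rfl | rfl⟩ := Int.even_or_odd' w
      · rw [if_pos (by omega), show 2 * t / 2 = t by omega]
        push_cast; ring
      · rw [if_neg (by omega), show (2 * t + 1 - 1) / 2 = t by omega]
        push_cast; ring
  · intro n
    refine (h2 (n - 1)).subset fun p hp => ?_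
    simp only [Set.mem_ofPred_eq] at hp ⊢
    push_cast at hp ⊢
    omega
  · intro p
    exact add_nonneg (nonneg_of_abs_le (abs_le_phi_exponent two_pos) p.1)
      (nonneg_of_abs_le (s 12 (by simp)) p.2)

/-- The substitution behind the identity `ψ(q)² = φ(q) ψ(q²)`. -/
def psiSqEquiv : ℤ × ℤ ≃ ℤ × ℤ where
  toFun p := if p.1 % 2 = 0 then (p.2 + p.1 / 2, p.2 - p.1 / 2)
    else (-p.2 + (p.1 - 1) / 2, -p.2 - 1 - (p.1 - 1) / 2)
  invFun p := if (p.1 - p.2) % 2 = 0 then (p.1 - p.2, (p.1 + p.2) / 2)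
    else (p.1 - p.2, (-p.1 - p.2 - 1) / 2)
  left_inv := by
    rintro ⟨v, k⟩
    dsimp only
    rcases Int.emod_two_eq_zero_or_one v with h | h
    · simp only [h, if_true]
      rw [if_pos (by omega)]
      ext <;> dsimp only <;> omega
    · simp only [h, one_ne_zero, if_false]
      rw [if_neg (by omega)]
      ext <;> dsimp only <;> omega
  right_inv := by
    rintro ⟨a, b⟩
    dsimp only
    by_cases h : (a - b) % 2 = 0
    · simp only [h, if_true]
      ext <;> dsimp only <;> omega
    · simp only [h, if_false]
      ext <;> dsimp only <;> omega

/-- Here 8E + 2 = (4a+1)^2 + (4b+1)^2 = 8(a-b)^2 + 2(2a+2b+1)^2; take v = a - b and 2a + 2b + 1 =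
±(4k+1). -/
theorem psiSeries_sq : psiSeries R 1 ^ 2 = phiSeries R 1 * psiSeries R 2 := by
  have s (k : ℕ) (hk : 0 < k) := abs_le_psi_exponent hk
  rw [sq, psiSeries, psiSeries, phiSeries, thetaSeries_mul_thetaSeries (s 1 one_pos) (s 1 one_pos),
    thetaSeries_mul_thetaSeries (abs_le_phi_exponent one_pos) (s 2 two_pos)]
  symm
  refine thetaSeries.congr_equiv psiSqEquiv ?_
  rintro ⟨v, k⟩
  simp only [psiSqEquiv, Equiv.coe_fn_mk]
  obtain ⟨t, rfl | rfl⟩ := Int.even_or_odd' v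
  · rw [if_pos (by omega), show 2 * t / 2 = t by omega]
    push_cast; ring
  · rw [if_neg (by omega), show (2 * t + 1 - 1) / 2 = t by omega]
    push_cast; ring

/-- The integers split into the even ones, those `≡ 1 [ZMOD 4]` and those `≡ 3 [ZMOD 4]`. -/
def intSumIntSumIntEquiv : ℤ ⊕ (ℤ ⊕ ℤ) ≃ ℤ where
  toFun
    | .inl n => 2 * n
    | .inr (.inl n) => 4 * n + 1
    | .inr (.inr n) => -(4 * n + 1)
  invFun n := if n % 2 = 0 then Sum.inl (n / 2)
    else if n % 4 = 1 then Sum.inr (Sum.inl (n / 4)) else Sum.inr (Sum.inr ((-n - 1) / 4))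
  left_inv := by
    rintro (n | n | n)
    · simp
    · dsimp only
      split_ifs <;> first | omega | (congr 2; omega)
    · dsimp only
      split_ifs <;> first | omega | (congr 2; omega)
  right_inv := by
    intro n
    dsimp only
    split_ifs <;> dsimp only <;> omega

theorem phiSeries_one : phiSeries R 1 = phiSeries R 4 + 2 * (X * psiSeries R 8) := by
  have s := abs_le_psi_exponent (k := 8) (by simp)
  have hf (n : ℤ) : {i : ℤ | ((1 : ℕ) : ℤ) + (8 : ℕ) * (i * (2 * i + 1)) = n}.Finite := by
    refine (finite_fibre_of_abs_le s (n - 1)).subset fun p hp => ?_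
    simp only [Set.mem_ofPred_eq] at hp ⊢
    omega
  rw [phiSeries, phiSeries, psiSeries, two_mul, ← pow_one X,
    thetaSeries.X_pow_mul (nonneg_of_abs_le s), ← thetaSeries.sum_elim hf hf,
    ← thetaSeries.sum_elim (finite_fibre_of_abs_le (abs_le_phi_exponent (by simp)))]
  · symm
    refine thetaSeries.congr_equiv intSumIntSumIntEquiv ?_
    rintro (n | n | n) <;> simp [intSumIntSumIntEquiv] <;> ring
  · intro n
    refine (((hf n).image Sum.inl).union ((hf n).image Sum.inr)).subset ?_
    rintro (i | i) hi <;> simpa using hi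

/-- The integers split into zero, the positive and the negative ones. -/
def unitSumNatSumNatEquiv : Unit ⊕ (ℕ ⊕ ℕ) ≃ ℤ where
  toFun
    | .inl _ => 0
    | .inr (.inl n) => n + 1
    | .inr (.inr n) => -(n + 1)
  invFun n := if n = 0 then Sum.inl () else if 0 < n then Sum.inr (Sum.inl (n - 1).toNat)
    else Sum.inr (Sum.inr (-n - 1).toNat)
  left_inv := by
    rintro (n | n | n)
    · simp
    · dsimp only
      split_ifs <;> first | omega | (congr 2; omega)
    · dsimp only
      split_ifs <;> first | omega | (congr 2; omega)
  right_inv := by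
    intro n
    dsimp only
    split_ifs <;> dsimp only <;> omega

/-- Pairing n with -n; this is the source of every congruence for φ modulo 4. -/
theorem exists_phiSeries_eq : ∃ S : R⟦X⟧, phiSeries R 1 = 1 + 2 * S := by
  have hinj (n : ℤ) : {i : ℕ | ((i : ℤ) + 1) ^ 2 = n}.Finite := by
    refine (Set.finite_Iic n.toNat).subset fun i hi => ?_
    simp only [Set.mem_ofPred_eq, Set.mem_Iic] at hi ⊢
    zify
    refine le_trans ?_ (Int.self_le_toNat n)
    nlinarith
  have h1 : (1 : R⟦X⟧) = thetaSeries R fun _ : Unit => 0 := by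
    ext n
    rw [thetaSeries.coeff_eq, coeff_one]
    split_ifs with h
    · subst h; simp
    · have h' : ¬ (0 : ℤ) = n := by omega
      simp [h']
  refine ⟨thetaSeries R fun n : ℕ => ((n : ℤ) + 1) ^ 2, ?_⟩
  rw [two_mul, h1, ← thetaSeries.sum_elim hinj hinj, ← thetaSeries.sum_elim, phiSeries]
  · symm
    refine thetaSeries.congr_equiv unitSumNatSumNatEquiv ?_
    rintro (n | n | n)
    · simp [unitSumNatSumNatEquiv]
    · simp [unitSumNatSumNatEquiv]
    · simp only [unitSumNatSumNatEquiv, Equiv.coe_fn_mk, Sum.elim_inr, Nat.cast_one]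
      ring
  · exact fun n => Set.toFinite _
  · intro n
    refine (((hinj n).image Sum.inl).union ((hinj n).image Sum.inr)).subset ?_
    rintro (i | i) hi <;> simpa using hi

/-- The bijection `ℤ ≃ ℕ` matching the exponent `n (2 n + 1)` with the `m`-th triangular number. -/
def intEquivNatTriangular : ℤ ≃ ℕ where
  toFun n := if 0 ≤ n then (2 * n).toNat else (-2 * n - 1).toNat
  invFun m := if m % 2 = 0 then (m / 2 : ℕ) else -((m + 1) / 2 : ℕ)
  left_inv n := by
    dsimp only
    split_ifs <;> omega
  right_inv m := by
    dsimp only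
    split_ifs <;> omega

theorem coeff_psiSeries_one (n : ℕ) :
    coeff n (psiSeries R 1) = ({m : ℕ | m * (m + 1) / 2 = n}.ncard : R) := by
  have h : psiSeries R 1 = thetaSeries R fun m : ℕ => ((m * (m + 1) / 2 : ℕ) : ℤ) := by
    refine thetaSeries.congr_equiv intEquivNatTriangular fun n => ?_
    simp only [intEquivNatTriangular, Equiv.coe_fn_mk]
    split_ifs with h
    · lift n to ℕ using h
      rw [show (2 * (n : ℤ)).toNat = 2 * n by omega,
        show 2 * n * (2 * n + 1) / 2 = n * (2 * n + 1) from
          Nat.div_eq_of_eq_mul_right two_pos (by ring)]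
      push_cast; ring
    · obtain ⟨m, rfl⟩ : ∃ m : ℕ, n = -(m + 1) := ⟨(-n - 1).toNat, by omega⟩
      rw [show (-2 * -((m : ℤ) + 1) - 1).toNat = 2 * m + 1 by omega,
        show (2 * m + 1) * (2 * m + 1 + 1) / 2 = (2 * m + 1) * (m + 1) from
          Nat.div_eq_of_eq_mul_right two_pos (by ring)]
      push_cast; ring
  rw [h, thetaSeries.coeff_eq]
  norm_cast

end Theta

/-! ### A finite form of Gauss' identity. -/

section Finite
open Finset

/-- Shanks' finite form of Gauss' product formula for `ψ`. -/
theorem sum_pow_triangular_mul_prod {A : Type*} [CommRing A] (q : A) (n : ℕ) :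
    (∑ s ∈ range (2 * n + 1), q ^ (s * (s + 1) / 2)) * ∏ k ∈ range n, (1 - q ^ (2 * k + 1)) =
      ∑ s ∈ range (n + 1), q ^ (s * (2 * n + 1)) *
        ((∏ k ∈ range s, (1 - q ^ (2 * k + 1))) * ∏ k ∈ Ico s n, (1 - q ^ (2 * k + 2))) := by
  induction n with
  | zero => simp
  | succ n ih =>
    -- The right side for n + 1, minus 1 - q^(2n+1) times the right side for n, telescopes in s. At
    -- m = n + 1 the factor 1 - q^(2m) should cancel against the product over `Ico m n`, which is
    -- merely empty there; the `if` term restores the value.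
    have tel : ∀ m ≤ n + 1, ∑ s ∈ range m, (q ^ (s * (2 * n + 3)) *
          ((∏ k ∈ range s, (1 - q ^ (2 * k + 1))) * ∏ k ∈ Ico s (n + 1), (1 - q ^ (2 * k + 2))) -
        (1 - q ^ (2 * n + 1)) * (q ^ (s * (2 * n + 1)) *
          ((∏ k ∈ range s, (1 - q ^ (2 * k + 1))) * ∏ k ∈ Ico s n, (1 - q ^ (2 * k + 2))))) =
        q ^ (m * (2 * n + 1)) * (1 - q ^ (2 * m)) *
          ((∏ k ∈ range m, (1 - q ^ (2 * k + 1))) * ∏ k ∈ Ico m n, (1 - q ^ (2 * k + 2))) +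
        (if m = n + 1 then q ^ (m * (2 * n + 1)) * q ^ (2 * m) *
          ∏ k ∈ range m, (1 - q ^ (2 * k + 1)) else 0) := by
      intro m hm
      induction m with
      | zero => simp
      | succ m ihm =>
        rw [sum_range_succ, ihm (by omega), if_neg (by omega), prod_Ico_succ_top (by omega),
          prod_range_succ _ m]
        rcases (show m ≤ n by omega).eq_or_lt with rfl | h
        · rw [if_pos rfl, Ico_self, Ico_eq_empty_of_le (Nat.le_succ m)]
          simp only [prod_empty]
          ring
        · rw [if_neg (by omega), prod_eq_prod_Ico_succ_bot h]
          ring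
    have h := tel (n + 1) le_rfl
    rw [sum_sub_distrib, ← mul_sum, ← ih, sub_eq_iff_eq_add] at h
    rw [sum_range_succ _ (n + 1), show 2 * (n + 1) + 1 = 2 * n + 3 by ring, h,
      show 2 * n + 3 = 2 * n + 1 + 1 + 1 by ring, sum_range_succ, sum_range_succ, if_pos rfl,
      Ico_self, Ico_eq_empty_of_le (Nat.le_succ n),
      show (2 * n + 1) * (2 * n + 1 + 1) / 2 = (n + 1) * (2 * n + 1) from
          Nat.div_eq_of_eq_mul_right two_pos (by ring),
      show (2 * n + 1 + 1) * (2 * n + 1 + 1 + 1) / 2 = (n + 1) * (2 * n + 3) from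
          Nat.div_eq_of_eq_mul_right two_pos (by ring), prod_range_succ]
    simp only [prod_empty]
    ring

end Finite

/-! ### Euler products and Gauss' product formula. -/

section Products

variable (R : Type*) [CommRing R] [TopologicalSpace R]

/-- The Euler product `∏ (1 - X ^ (k i))` over `i ≥ 1`. -/
noncomputable def eulerProd (k : ℕ) : R⟦X⟧ := ∏' i : ℕ, (1 - X ^ (k * (i + 1)))

/-- The Euler product `∏ (1 - X ^ (k i))` over odd `i`. -/
noncomputable def oddEulerProd (k : ℕ) : R⟦X⟧ := ∏' i : ℕ, (1 - X ^ (k * (2 * i + 1)))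

variable {R}

theorem multipliable_one_add_of_X_pow_dvd {a : ℕ → R⟦X⟧} (h : ∀ i, X ^ i ∣ a i) :
    Multipliable fun i => 1 + a i := by
  refine WithPiTopology.multipliable_one_add_of_tendsto_order_atTop_nhds_top R ?_
  refine ENat.tendsto_nhds_top_iff_natCast_lt.mpr fun n =>
    Filter.eventually_atTop.mpr ⟨n + 1, fun m hm => ?_⟩
  refine lt_of_lt_of_le ?_ (le_order _ m fun i hi => ?_)
  · exact_mod_cast hm
  · exact X_pow_dvd_iff.1 (h m) i (by exact_mod_cast hi)

theorem multipliable_one_sub_X_pow_of_le {e : ℕ → ℕ} (h : ∀ i, i ≤ e i) :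
    Multipliable fun i => (1 : R⟦X⟧) - X ^ e i := by
  simp only [sub_eq_add_neg]
  exact multipliable_one_add_of_X_pow_dvd fun i => (pow_dvd_pow X (h i)).neg_right

theorem multipliable_eulerProd {k : ℕ} (hk : k ≠ 0) :
    Multipliable fun i => (1 : R⟦X⟧) - X ^ (k * (i + 1)) :=
  multipliable_one_sub_X_pow_of_le fun i => by
    have := Nat.le_mul_of_pos_left (i + 1) (Nat.pos_of_ne_zero hk)
    omega

theorem multipliable_oddEulerProd {k : ℕ} (hk : k ≠ 0) :
    Multipliable fun i => (1 : R⟦X⟧) - X ^ (k * (2 * i + 1)) :=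
  multipliable_one_sub_X_pow_of_le fun i => by
    have := Nat.le_mul_of_pos_left (2 * i + 1) (Nat.pos_of_ne_zero hk)
    omega

theorem continuous_expand (k : ℕ) (hk : k ≠ 0) :
    Continuous (expand k hk : R⟦X⟧ → R⟦X⟧) := by
  refine continuous_iff_continuousAt.2 fun f => ?_
  rw [ContinuousAt, WithPiTopology.tendsto_iff_coeff_tendsto]
  intro d
  simp only [coeff_expand]
  split_ifs
  · exact (WithPiTopology.continuous_coeff R _).continuousAt
  · exact tendsto_const_nhds

variable [T2Space R]

theorem expand_eulerProd (j : ℕ) (hj : j ≠ 0) {k : ℕ} (hk : k ≠ 0) :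
    expand j hj (eulerProd R k) = eulerProd R (j * k) := by
  rw [eulerProd, (multipliable_eulerProd hk).map_tprod _ (continuous_expand j hj), eulerProd]
  refine tprod_congr fun i => ?_
  rw [map_sub, map_one, map_pow, expand_X, ← pow_mul, mul_assoc]

theorem isUnit_eulerProd {k : ℕ} (hk : k ≠ 0) : IsUnit (eulerProd R k) := by
  rw [isUnit_iff_constantCoeff, eulerProd, (multipliable_eulerProd hk).map_tprod
    _ (WithPiTopology.continuous_constantCoeff R)]
  simp [hk]

variable [IsTopologicalRing R]

theorem eulerProd_eq {k : ℕ} (hk : k ≠ 0) :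
    eulerProd R k = oddEulerProd R k * eulerProd R (2 * k) := by
  have h := tprod_even_mul_odd (f := fun i : ℕ => (1 : R⟦X⟧) - X ^ (k * (i + 1)))
    (multipliable_oddEulerProd hk) (by
      refine (multipliable_eulerProd (R := R) (k := 2 * k) (by simpa)).congr fun i => ?_
      congr 2; ring)
  rw [eulerProd, ← h, oddEulerProd, eulerProd]
  congr 1
  refine tprod_congr fun i => ?_
  congr 2; ring

/-- Gauss' product formula for `ψ`. -/
theorem psiSeries_mul_oddEulerProd : psiSeries R 1 * oddEulerProd R 1 = eulerProd R 2 := by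
  open Filter Topology in
  have h1 : Tendsto (fun n : ℕ => ∑ s ∈ Finset.range (2 * n + 1), (X : R⟦X⟧) ^ (s * (s + 1) / 2))
      atTop (𝓝 (psiSeries R 1)) := by
    rw [WithPiTopology.tendsto_iff_coeff_tendsto]
    intro d
    refine tendsto_atTop_of_eventually_const (i₀ := d) fun n hn => ?_
    rw [coeff_psiSeries_one, map_sum]
    simp only [coeff_X_pow, Finset.sum_boole]
    congr 1
    rw [← Set.ncard_coe_finset]
    congr 1
    ext m
    simp only [Finset.coe_filter, Finset.mem_range, Set.mem_ofPred_eq]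
    have : m ≤ m * (m + 1) / 2 := by
      rw [Nat.le_div_iff_mul_le two_pos]
      rcases m with _ | m <;> nlinarith
    omega
  have h2 : Tendsto (fun n : ℕ => ∏ k ∈ Finset.range n, (1 - (X : R⟦X⟧) ^ (2 * k + 1)))
      atTop (𝓝 (oddEulerProd R 1)) := by
    have := (multipliable_oddEulerProd (R := R) one_ne_zero).hasProd.tendsto_prod_nat
    simpa only [one_mul, oddEulerProd] using this
  have h3 : Tendsto (fun n : ℕ => ∏ k ∈ Finset.range n, (1 - (X : R⟦X⟧) ^ (2 * k + 2)))
      atTop (𝓝 (eulerProd R 2)) :=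
    (multipliable_eulerProd (R := R) two_ne_zero).hasProd.tendsto_prod_nat
  -- These are the terms s ≥ 1 of the finite identity, all divisible by X^(2n+1). Only the term s =
  -- 0, which is the product in `h3`, survives in the limit.
  have h4 : Tendsto (fun n : ℕ => ∑ s ∈ Finset.range n, (X : R⟦X⟧) ^ ((s + 1) * (2 * n + 1)) *
        ((∏ k ∈ Finset.range (s + 1), (1 - X ^ (2 * k + 1))) *
          ∏ k ∈ Finset.Ico (s + 1) n, (1 - X ^ (2 * k + 2)))) atTop (𝓝 0) := by
    rw [WithPiTopology.tendsto_iff_coeff_tendsto]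
    intro d
    refine tendsto_atTop_of_eventually_const (i₀ := d) fun n hn => ?_
    rw [map_zero]
    have : (X : R⟦X⟧) ^ (2 * n + 1) ∣ ∑ s ∈ Finset.range n, (X : R⟦X⟧) ^ ((s + 1) * (2 * n + 1)) *
        ((∏ k ∈ Finset.range (s + 1), (1 - X ^ (2 * k + 1))) *
          ∏ k ∈ Finset.Ico (s + 1) n, (1 - X ^ (2 * k + 2))) :=
      Finset.dvd_sum fun s _ => ((pow_dvd_pow X (by nlinarith)).mul_right _)
    exact X_pow_dvd_iff.1 this d (by omega)
  refine tendsto_nhds_unique (h1.mul h2) ?_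
  refine (add_zero (eulerProd R 2) ▸ h3.add h4).congr fun n => ?_
  rw [sum_pow_triangular_mul_prod, Finset.sum_range_succ', add_comm]
  simp

theorem psiSeries_mul_eulerProd {k : ℕ} (hk : k ≠ 0) :
    psiSeries R k * eulerProd R k = eulerProd R (2 * k) ^ 2 := by
  have h : psiSeries R 1 * eulerProd R 1 = eulerProd R 2 ^ 2 := by
    rw [eulerProd_eq one_ne_zero, ← mul_assoc, psiSeries_mul_oddEulerProd, sq, mul_one]
  have := congrArg (expand k hk) h
  rwa [map_mul, map_pow, expand_psiSeries, expand_eulerProd _ _ one_ne_zero,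
    expand_eulerProd _ _ two_ne_zero, mul_one, mul_comm k 2] at this

end Products

/-! ### The generating function of `PD 2` as an Euler quotient. -/

section GenFun

variable (R : Type*) [CommRing R]

theorem PD_eq_sum (k n : ℕ) : PD k n = ∑ p : n.Partition,
    p.parts.toFinsupp.prod fun i c => if k ∣ i then 0 else c := by
  classical
  rw [PD, Fintype.card_subtype, Finset.card_filter, Fintype.sum_sigma]
  refine Finset.sum_congr rfl fun p _ => ?_
  rw [Finsupp.prod, Multiset.toFinsupp_support]
  simp only [Multiset.toFinsupp_apply]
  by_cases h : ∀ i ∈ p.parts, ¬ k ∣ i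
  · refine (Finset.sum_congr rfl fun y _ => if_pos h).trans ?_
    rw [Finset.sum_const, Finset.card_univ, Fintype.card_pi, smul_eq_mul, mul_one]
    simp only [Fintype.card_fin]
    refine (Finset.prod_coe_sort p.parts.toFinset fun i => p.parts.count i).trans ?_
    exact Finset.prod_congr rfl fun i hi => (if_neg (h i (by simpa using hi))).symm
  · refine (Finset.sum_congr rfl fun y _ => if_neg h).trans ?_
    push Not at h
    obtain ⟨i, hi, hk⟩ := h
    rw [Finset.sum_const_zero, eq_comm]
    exact Finset.prod_eq_zero (i := i) (by simpa using hi) (if_pos hk)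

/-- The generating function of `PD k`. -/
noncomputable def PDSeries (k : ℕ) : R⟦X⟧ := PowerSeries.mk fun n => (PD k n : R)

theorem PDSeries_eq_genFun (k : ℕ) :
    PDSeries R k = Nat.Partition.genFun fun i c => if k ∣ i then 0 else (c : R) := by
  ext n
  rw [PDSeries, coeff_mk, Nat.Partition.coeff_genFun, PD_eq_sum, Nat.cast_sum]
  refine Finset.sum_congr rfl fun p _ => ?_
  simp [Finsupp.prod]

variable {R} [TopologicalSpace R] [T2Space R] [IsTopologicalRing R]

/-- With y = X^i and S the sum, shifting the index gives S = y + y S + y^2 ∑ y^j, hence (1 - y)^2 S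
= y. -/
theorem one_add_tsum_mul_one_sub_sq {i : ℕ} (hi : i ≠ 0) :
    (1 + ∑' j : ℕ, ((j + 1 : ℕ) : R) • (X : R⟦X⟧) ^ (i * (j + 1))) * (1 - X ^ i) ^ 2 =
      1 - X ^ i + X ^ (2 * i) := by
  have hs := Nat.Partition.summable_genFun_term' (R := R) (fun _ c => (c : R)) hi
  have h0 : ((X : R⟦X⟧) ^ i).constantCoeff = 0 := by simp [hi]
  have hgs := WithPiTopology.summable_pow_of_constantCoeff_eq_zero h0
  have hg := WithPiTopology.tsum_pow_mul_one_sub_of_constantCoeff_eq_zero h0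
  have e1 := hs.tsum_eq_zero_add
  have e2 := hs.tsum_mul_left ((X : R⟦X⟧) ^ i)
  have e3 := hgs.tsum_mul_left (((X : R⟦X⟧) ^ i) ^ 2)
  have e4 := (hs.mul_left ((X : R⟦X⟧) ^ i)).tsum_add (hgs.mul_left (((X : R⟦X⟧) ^ i) ^ 2))
  have e5 : ∑' j : ℕ, ((j + 1 + 1 : ℕ) : R) • (X : R⟦X⟧) ^ (i * (j + 1 + 1)) =
      ∑' j : ℕ, (X ^ i * (((j + 1 : ℕ) : R) • X ^ (i * (j + 1))) + (X ^ i) ^ 2 * (X ^ i) ^ j) := by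
    refine tsum_congr fun j => ?_
    rw [Nat.cast_add (j + 1) 1, add_smul, Nat.cast_one, one_smul, mul_smul_comm]
    ring_nf
  rw [e5, e4, e2, e3] at e1
  simp only [zero_add, Nat.cast_one, one_smul, mul_one] at e1
  rw [mul_comm 2 i, pow_mul]
  linear_combination (1 - X ^ i) * e1 + (X ^ i) ^ 2 * hg

/-- Factor by factor, with y = X^(2i+1): since (1 + y)(1 - y + y^2) = 1 + y^3, the factor (1 - y +
y^2) / (1 - y)^2 equals (1 - y^6) / ((1 - y)(1 - y^2)(1 - y^3)). -/
theorem PDSeries_two_mul_oddEulerProd :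
    PDSeries R 2 * oddEulerProd R 1 * oddEulerProd R 2 * oddEulerProd R 3 = oddEulerProd R 6 := by
  set a : ℕ → R⟦X⟧ := fun i => ∑' j : ℕ, ((j + 1 : ℕ) : R) • (X : R⟦X⟧) ^ ((2 * i + 1) * (j + 1))
  have ha (i : ℕ) : (1 + a i) * (1 - X ^ (2 * i + 1)) ^ 2 =
      1 - X ^ (2 * i + 1) + X ^ (2 * (2 * i + 1)) := one_add_tsum_mul_one_sub_sq (by simp)
  have hm : Multipliable fun i => 1 + a i := by
    refine multipliable_one_add_of_X_pow_dvd fun i => ?_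
    -- From a (1 - y)^2 = y one gets a = y (1 + a (2 - y)).
    refine (pow_dvd_pow X (show i ≤ 2 * i + 1 by omega)).trans
      ⟨1 + a i * (2 - X ^ (2 * i + 1)), ?_⟩
    have := ha i
    rw [mul_comm 2 (2 * i + 1), pow_mul] at this
    linear_combination this
  have hG : PDSeries R 2 = ∏' i, (1 + a i) := by
    rw [PDSeries_eq_genFun, Nat.Partition.genFun_eq_tprod]
    have h1 (k : ℕ) : ¬ 2 ∣ 2 * k + 1 := by omega
    have h2 (k : ℕ) : 2 ∣ 2 * k + 1 + 1 := by omega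
    rw [← tprod_even_mul_odd]
    · simp only [h1, h2, if_true, if_false, zero_smul, tsum_zero, add_zero, tprod_one, mul_one]
      rfl
    · simp only [h1, if_false]
      exact hm
    · simp only [h2, if_true, zero_smul, tsum_zero, add_zero]
      exact multipliable_one
  have m1 := multipliable_oddEulerProd (R := R) one_ne_zero
  have m2 := multipliable_oddEulerProd (R := R) two_ne_zero
  have m3 := multipliable_oddEulerProd (R := R) three_ne_zero
  rw [hG, oddEulerProd, oddEulerProd, oddEulerProd, oddEulerProd, ← hm.tprod_mul m1,
    ← (hm.mul m1).tprod_mul m2, ← ((hm.mul m1).mul m2).tprod_mul m3]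
  refine tprod_congr fun i => ?_
  have := ha i
  simp only [mul_comm _ (2 * i + 1), pow_mul _ (2 * i + 1)] at this ⊢
  linear_combination (1 + X ^ (2 * i + 1)) * (1 - (X ^ (2 * i + 1)) ^ 3) * this

theorem PDSeries_two_mul_eulerProd :
    PDSeries R 2 * eulerProd R 1 * eulerProd R 3 * eulerProd R 12 =
      eulerProd R 4 * eulerProd R 6 ^ 2 := by
  have h := PDSeries_two_mul_oddEulerProd (R := R)
  have h1 := eulerProd_eq (R := R) one_ne_zero
  have h2 := eulerProd_eq (R := R) two_ne_zero
  have h3 := eulerProd_eq (R := R) three_ne_zero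
  have h6 := eulerProd_eq (R := R) (k := 6) (by simp)
  norm_num at h1 h2 h3 h6
  rw [h1, h2, h3, sq]
  nth_rw 2 [h6]
  linear_combination eulerProd R 4 * eulerProd R 6 * eulerProd R 12 * h

end GenFun

/-! ### Congruences and 2-dissections modulo 4. -/

section ModFour

variable {R : Type*} [CommRing R]

theorem phiSeries_eq_expand {k : ℕ} (hk : k ≠ 0) :
    phiSeries R k = expand k hk (phiSeries R 1) := by
  rw [expand_phiSeries, mul_one]

theorem phiSeries_sq_of_four_eq_zero (h4 : (4 : R⟦X⟧) = 0) {k : ℕ} (hk : k ≠ 0) :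
    phiSeries R k ^ 2 = 1 := by
  obtain ⟨S, hS⟩ := exists_phiSeries_eq (R := R)
  rw [phiSeries_eq_expand hk, ← map_pow, hS,
    show (1 + 2 * S) ^ 2 = 1 by linear_combination (S + S ^ 2) * h4, map_one]

theorem two_mul_phiSeries_of_four_eq_zero (h4 : (4 : R⟦X⟧) = 0) {k : ℕ} (hk : k ≠ 0) :
    2 * phiSeries R k = 2 := by
  obtain ⟨S, hS⟩ := exists_phiSeries_eq (R := R)
  rw [phiSeries_eq_expand hk, hS, map_add, map_mul, map_one, map_ofNat]
  linear_combination expand k hk S * h4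

variable [TopologicalSpace R] [T2Space R] [IsTopologicalRing R]

/-- Termwise, (1 - y)^4 and (1 - y^2)^2 differ by a multiple of 4. -/
theorem eulerProd_one_pow_four (h4 : (4 : R⟦X⟧) = 0) : eulerProd R 1 ^ 4 = eulerProd R 2 ^ 2 := by
  rw [eulerProd, eulerProd, ← (multipliable_eulerProd one_ne_zero).tprod_pow,
    ← (multipliable_eulerProd two_ne_zero).tprod_pow]
  refine tprod_congr fun i => ?_
  rw [one_mul, mul_comm 2, pow_mul]
  set y := (X : R⟦X⟧) ^ (i + 1)
  linear_combination (-y + 2 * y ^ 2 - y ^ 3) * h4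

/-- By `psiSeries_sq` and the product for ψ, φ(q) f_1^2 = f_2^5 / f_4^2, and f_2^4 = f_4^2 modulo 4.
-/
theorem phiSeries_mul_eulerProd_sq (h4 : (4 : R⟦X⟧) = 0) {k : ℕ} (hk : k ≠ 0) :
    phiSeries R k * eulerProd R k ^ 2 = eulerProd R (2 * k) := by
  have h : phiSeries R 1 * eulerProd R 1 ^ 2 = eulerProd R 2 := by
    have h1 := psiSeries_mul_eulerProd (R := R) one_ne_zero
    have h2 := psiSeries_mul_eulerProd (R := R) two_ne_zero
    have h3 := congrArg (expand 2 two_ne_zero) (eulerProd_one_pow_four h4)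
    rw [map_pow, map_pow, expand_eulerProd _ _ one_ne_zero, expand_eulerProd _ _ two_ne_zero] at h3
    norm_num at h1 h2 h3
    refine ((isUnit_eulerProd (R := R) four_ne_zero).pow 2).mul_left_cancel ?_
    linear_combination (-phiSeries R 1 * eulerProd R 1 ^ 2) * h2 -
      eulerProd R 1 ^ 2 * eulerProd R 2 * psiSeries_sq (R := R) +
      eulerProd R 2 * (psiSeries R 1 * eulerProd R 1 + eulerProd R 2 ^ 2) * h1 + eulerProd R 2 * h3
  have := congrArg (expand k hk) h
  rwa [map_mul, map_pow, expand_phiSeries, expand_eulerProd _ _ one_ne_zero,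
    expand_eulerProd _ _ two_ne_zero, mul_one, mul_comm k 2] at this

omit [IsTopologicalRing R] in
theorem eulerProd_mul_inverse {k : ℕ} (hk : k ≠ 0) :
    eulerProd R k * Ring.inverse (eulerProd R k) = 1 :=
  Ring.mul_inverse_cancel _ (isUnit_eulerProd hk)

omit [IsTopologicalRing R] in
theorem expand_inverse_eulerProd (j : ℕ) (hj : j ≠ 0) {k : ℕ} (hk : k ≠ 0) :
    expand j hj (Ring.inverse (eulerProd R k)) = Ring.inverse (eulerProd R (j * k)) := by
  refine left_inv_eq_right_inv (a := eulerProd R (j * k)) ?_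
    (eulerProd_mul_inverse (mul_ne_zero hj hk))
  rw [← expand_eulerProd j hj hk, ← map_mul, mul_comm, eulerProd_mul_inverse hk, map_one]

/-- Substitute f_4 = φ(q^2) f_2^2, f_2^2 = ψ(q) f_1 and f_6^2 = ψ(q^3) f_3 into the Euler quotient.
-/
theorem PDSeries_two_eq (h4 : (4 : R⟦X⟧) = 0) :
    PDSeries R 2 =
      phiSeries R 2 * (psiSeries R 1 * psiSeries R 3) * Ring.inverse (eulerProd R 12) := by
  have u := ((isUnit_eulerProd (R := R) one_ne_zero).mul (isUnit_eulerProd three_ne_zero)).mul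
    (isUnit_eulerProd (k := 12) (by simp))
  refine u.mul_left_cancel ?_
  have h1 := psiSeries_mul_eulerProd (R := R) one_ne_zero
  have h3 := psiSeries_mul_eulerProd (R := R) three_ne_zero
  have hp := phiSeries_mul_eulerProd_sq h4 two_ne_zero
  have hi := eulerProd_mul_inverse (R := R) (k := 12) (by simp)
  norm_num at h1 h3 hp hi
  linear_combination PDSeries_two_mul_eulerProd (R := R) - eulerProd R 6 ^ 2 * hp -
    phiSeries R 2 * psiSeries R 1 * psiSeries R 3 * eulerProd R 1 * eulerProd R 3 * hi -
    phiSeries R 2 * eulerProd R 6 ^ 2 * h1 -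
    phiSeries R 2 * psiSeries R 1 * eulerProd R 1 * h3

/-- The 2-dissection of the generating function of `PD 2` when `4 = 0`. -/
theorem PDSeries_two_dissection (h4 : (4 : R⟦X⟧) = 0) :
    PDSeries R 2 =
      expand 2 two_ne_zero (phiSeries R 1 * phiSeries R 3 * psiSeries R 2 *
        Ring.inverse (eulerProd R 6)) +
      X * expand 4 four_ne_zero (psiSeries R 3 * Ring.inverse (eulerProd R 3)) := by
  simp only [map_mul, expand_phiSeries, expand_psiSeries]
  rw [expand_inverse_eulerProd _ _ (by simp), expand_inverse_eulerProd _ _ (by simp),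
    PDSeries_two_eq h4, psiSeries_mul_psiSeries_three]
  norm_num
  linear_combination X * psiSeries R 12 * Ring.inverse (eulerProd R 12) *
    phiSeries_sq_of_four_eq_zero h4 two_ne_zero

/-- The 2-dissection of the generating function of `PD 2` at the even numbers when `4 = 0`. -/
theorem phiSeries_mul_psiSeries_dissection (h4 : (4 : R⟦X⟧) = 0) :
    phiSeries R 1 * phiSeries R 3 * psiSeries R 2 * Ring.inverse (eulerProd R 6) =
      expand 2 two_ne_zero (PDSeries R 2) + X * expand 4 four_ne_zero
        (2 * (psiSeries R 2 ^ 2 + X * psiSeries R 6 ^ 2) * Ring.inverse (eulerProd R 3) ^ 2) := by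
  have h1 : phiSeries R 6 * Ring.inverse (eulerProd R 3) =
      psiSeries R 3 * Ring.inverse (eulerProd R 12) := by
    have a := eulerProd_mul_inverse (R := R) three_ne_zero
    have b := eulerProd_mul_inverse (R := R) (k := 12) (by simp)
    have c := phiSeries_mul_eulerProd_sq (R := R) h4 (k := 6) (by simp)
    have d := phiSeries_sq_of_four_eq_zero (R := R) h4 (k := 6) (by simp)
    have e := psiSeries_mul_eulerProd (R := R) three_ne_zero
    norm_num at c e
    set I := Ring.inverse (eulerProd R 3)
    set J := Ring.inverse (eulerProd R 12)
    linear_combination psiSeries R 3 * J * a - I * phiSeries R 6 * b - I * J * e -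
      I * J * phiSeries R 6 * c + I * J * eulerProd R 6 ^ 2 * d
  have h2 : Ring.inverse (eulerProd R 3) = psiSeries R 3 * Ring.inverse (eulerProd R 6) ^ 2 := by
    have a := eulerProd_mul_inverse (R := R) three_ne_zero
    have b := eulerProd_mul_inverse (R := R) (k := 6) (by simp)
    have e := psiSeries_mul_eulerProd (R := R) three_ne_zero
    norm_num at e
    set I := Ring.inverse (eulerProd R 3)
    set J := Ring.inverse (eulerProd R 6)
    linear_combination psiSeries R 3 * J ^ 2 * a - I * J ^ 2 * e -
      I * (eulerProd R 6 * J + 1) * b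
  have h3 : PDSeries R 2 =
      phiSeries R 2 * phiSeries R 6 * psiSeries R 1 * Ring.inverse (eulerProd R 3) := by
    rw [PDSeries_two_eq h4]
    linear_combination (-phiSeries R 2 * psiSeries R 1) * h1
  -- After `h2`, the right side contains ψ(q) ψ(q^3); its dissection, with 2φ = 2, turns the
  -- expression into 2(ψ(q^4) + q ψ(q^12))^2 / f_6^2. The cross term carries a factor 4, leaving a
  -- series in q^2.
  have h5 : expand 2 two_ne_zero
        (2 * (psiSeries R 2 ^ 2 + X * psiSeries R 6 ^ 2) * Ring.inverse (eulerProd R 3) ^ 2) =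
      2 * (psiSeries R 4 + X * psiSeries R 12) * psiSeries R 1 *
        Ring.inverse (eulerProd R 3) := by
    have p2 := two_mul_phiSeries_of_four_eq_zero (R := R) h4 two_ne_zero
    have p6 := two_mul_phiSeries_of_four_eq_zero (R := R) h4 (k := 6) (by simp)
    have e := psiSeries_mul_psiSeries_three (R := R)
    simp only [map_mul, map_add, map_pow, expand_psiSeries, expand_X, map_ofNat]
    rw [expand_inverse_eulerProd _ _ three_ne_zero, h2]
    norm_num
    set J := Ring.inverse (eulerProd R 6)
    set a := psiSeries R 4
    set b := psiSeries R 12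
    linear_combination (-2 * (a + X * b) * J ^ 2) * e - (a + X * b) * a * J ^ 2 * p6 -
      (a + X * b) * X * b * J ^ 2 * p2 - X * a * b * J ^ 2 * h4
  have h6 : phiSeries R 3 = phiSeries R 12 + 2 * (X ^ 3 * psiSeries R 24) := by
    have := congrArg (expand 3 three_ne_zero) (phiSeries_one (R := R))
    simpa only [map_add, map_mul, map_ofNat, expand_phiSeries, expand_psiSeries, expand_X] using this
  have p4 := two_mul_phiSeries_of_four_eq_zero (R := R) h4 four_ne_zero
  have p12 := two_mul_phiSeries_of_four_eq_zero (R := R) h4 (k := 12) (by simp)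
  have h7 := expand_mul 2 two_ne_zero 2 two_ne_zero
    (2 * (psiSeries R 2 ^ 2 + X * psiSeries R 6 ^ 2) * Ring.inverse (eulerProd R 3) ^ 2)
  rw [h5] at h7
  refine Eq.trans ?_ (congrArg (fun t => expand 2 two_ne_zero (PDSeries R 2) + X * t) h7.symm)
  -- Expand φ(q) φ(q^3): the product of leading terms gives G(q^2) by `h3`, the two mixed terms give
  -- the doubled series of `h5` at q^2, and the last term has a factor 4.
  rw [h3, phiSeries_one, h6]
  simp only [map_mul, map_add, expand_phiSeries, expand_psiSeries, expand_X, map_ofNat]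
  rw [expand_inverse_eulerProd _ _ three_ne_zero]
  norm_num
  set J := Ring.inverse (eulerProd R 6)
  linear_combination X * psiSeries R 8 * psiSeries R 2 * J * p12 +
    X ^ 3 * psiSeries R 24 * psiSeries R 2 * J * p4 +
    X ^ 4 * psiSeries R 8 * psiSeries R 24 * psiSeries R 2 * J * h4

end ModFour

/-! ### Reading off coefficients. -/

section Congruences

theorem coeff_X_mul_expand_four {R : Type*} [CommRing R] (p : R⟦X⟧) {m : ℕ} (hm : m % 4 ≠ 1) :
    coeff m (X * expand 4 four_ne_zero p) = 0 := by
  rcases m with _ | m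
  · simp
  · rw [coeff_succ_X_mul, coeff_expand_of_not_dvd]
    omega

theorem four_eq_zero_powerSeries_zmod : (4 : (ZMod 4)⟦X⟧) = 0 := by
  rw [← map_ofNat (C (R := ZMod 4)), show (OfNat.ofNat 4 : ZMod 4) = 0 by decide, map_zero]

theorem cast_PD_two_of_mod_four_eq_three {m : ℕ} (hm : m % 4 = 3) : (PD 2 m : ZMod 4) = 0 := by
  have h := congrArg (coeff m) (PDSeries_two_dissection four_eq_zero_powerSeries_zmod)
  rwa [PDSeries, coeff_mk, map_add, coeff_expand_of_not_dvd _ _ _ (by omega),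
    coeff_X_mul_expand_four _ (by omega), add_zero] at h

theorem cast_PD_two_two_mul (m : ℕ) :
    (PD 2 (2 * m) : ZMod 4) = coeff m (expand 2 two_ne_zero (PDSeries (ZMod 4) 2) +
      X * expand 4 four_ne_zero (2 * (psiSeries (ZMod 4) 2 ^ 2 + X * psiSeries (ZMod 4) 6 ^ 2) *
        Ring.inverse (eulerProd (ZMod 4) 3) ^ 2)) := by
  have h := congrArg (coeff (2 * m)) (PDSeries_two_dissection four_eq_zero_powerSeries_zmod)
  rwa [PDSeries, coeff_mk, map_add, coeff_expand_mul, coeff_X_mul_expand_four _ (by omega),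
    add_zero, phiSeries_mul_psiSeries_dissection four_eq_zero_powerSeries_zmod] at h

theorem cast_PD_two_two_mul_of_mod_four_eq_three {m : ℕ} (hm : m % 4 = 3) :
    (PD 2 (2 * m) : ZMod 4) = 0 := by
  rw [cast_PD_two_two_mul, map_add, coeff_expand_of_not_dvd _ _ _ (by omega),
    coeff_X_mul_expand_four _ (by omega), add_zero]

theorem cast_PD_two_four_mul (m : ℕ) : (PD 2 (4 * m) : ZMod 4) = PD 2 m := by
  rw [show 4 * m = 2 * (2 * m) by ring, cast_PD_two_two_mul, map_add, coeff_expand_mul,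
    coeff_X_mul_expand_four _ (by omega), add_zero, PDSeries, coeff_mk]

theorem cast_PD_two_two_pow_mul (α n : ℕ) : (PD 2 (2 ^ α * (4 * n + 3)) : ZMod 4) = 0 := by
  induction α using Nat.twoStepInduction with
  | zero => exact cast_PD_two_of_mod_four_eq_three (by omega)
  | one => exact cast_PD_two_two_mul_of_mod_four_eq_three (by omega)
  | more α ih _ =>
    rw [show 2 ^ (α + 2) * (4 * n + 3) = 4 * (2 ^ α * (4 * n + 3)) by ring, cast_PD_two_four_mul, ih]

end Congruences

theorem theorem1 :
    (∀ α n : ℕ, PD 2 (2 ^ α * (4 * n + 3)) ≡ 0 [MOD 4]) ∧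
    (∀ n : ℕ, PD 2 (16 * n + 12) ≡ 0 [MOD 4]) ∧
    (∀ n : ℕ, PD 2 (32 * n + 24) ≡ 0 [MOD 4]) := by
  have key (α n : ℕ) : PD 2 (2 ^ α * (4 * n + 3)) ≡ 0 [MOD 4] := by
    rw [← ZMod.natCast_eq_natCast_iff, Nat.cast_zero]
    exact cast_PD_two_two_pow_mul α n
  refine ⟨key, fun n => ?_, fun n => ?_⟩
  · rw [show 16 * n + 12 = 2 ^ 2 * (4 * n + 3) by ring]
    exact key 2 n
  · rw [show 32 * n + 24 = 2 ^ 3 * (4 * n + 3) by ring]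
    exact key 3 n
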